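/- Let $K$ be a number field and let $\mathbb{A}_K$ be its ring of adeles (over all places of $K$, archimedean and non-archimedean), with $a(v)\in K_v$ denoting the coordinate of an adele $a$ at the place $v$. "Definable" means definable, with parameters, by a first-order formula of the language of rings $\{+,-,\cdot,0,1\}$. A minimal idempotent of $\mathbb{A}_K$ is an idempotent $e\neq 0$ such that every idempotent $f$ with $fe=f$ is $0$ or $e$; the set $e\mathbb{A}_K$ is regarded as a ring with unit $e$. Theorem. The local fields $K_v$ are stably embedded in $\mathbb{A}_K$. Precisely: (1) For every place $v$ of $K$ there is exactly one minimal idempotent $e$ of $\mathbb{A}_K$ with $e(v)=1$. Conversely, for every minimal idempotent $e$ there is a place $v$ with $e(v)=1$ and $e(w)=0$ for all places $w\neq v$, and $x\mapsto x(v)$ is a ring isomorphism $\varphi_e:e\mathbb{A}_K\to K_v$. (2) Let $e$ be a minimal idempotent, corresponding to the place $v$, let $n\geq 1$, and let $X\subseteq\mathbb{A}_K^n$ be definable in $\mathbb{A}_K$ with parameters from $\mathbb{A}_K$. Then $X\cap(e\mathbb{A}_K)^n$ is definable in the ring $e\mathbb{A}_K$ with parameters from $e\mathbb{A}_K$; equivalently,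 its image in $K_v^n$ under $\varphi_e$ is definable in the field $K_v$ with parameters from $K_v$. (3) For every minimal idempotent $e$, the set $e\mathbb{A}_K$ is stably embedded in the ring $\mathbb{A}_K$: for every $n\ge 0$ and every $X\subseteq\mathbb{A}_K^n$ definable in $\mathbb{A}_K$ with parameters from $\mathbb{A}_K$, the set $X\cap(e\mathbb{A}_K)^n$ is definable in $\mathbb{A}_K$ with parameters from $e\mathbb{A}_K$. -/

import Mathlib

/-- A nonzero idempotent which is minimal for the order `f ≤ e ↔ f * e = f` on idempotents. -/
structure IsMinimalIdempotent {R : Type*} [CommRing R] (e : R) : Prop where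
  idem : IsIdempotentElem e
  ne_zero : e ≠ 0
  minimal : ∀ f : R, IsIdempotentElem f → f * e = f → f = 0 ∨ f = e

/-- `X ⊆ Rⁿ` is definable in the ring `R` by a first-order formula of the language of rings
`{+, -, ·, 0, 1}` with parameters from `A ⊆ R`. -/
def RingDefinableOver (R : Type*) [CommRing R] (A : Set R) {n : ℕ} (X : Set (Fin n → R)) : Prop :=
  letI := FirstOrder.Ring.compatibleRingOfRing R
  A.Definable FirstOrder.Language.ring X

/-- `X ⊆ Rⁿ` is definable in the ring `R` with arbitrary parameters from `R`. -/
def RingDefinable (R : Type*) [CommRing R] {n : ℕ} (X : Set (Fin n → R)) : Prop :=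
  RingDefinableOver R Set.univ X

/-- The subset `D ⊆ R` is stably embedded in the ring `R`: the trace on every `Dⁿ` of a subset of
`Rⁿ` definable with parameters from `R` is definable in `R` with parameters from `D`. -/
def IsStablyEmbedded (R : Type*) [CommRing R] (D : Set R) : Prop :=
  ∀ (n : ℕ) (X : Set (Fin n → R)), RingDefinable R X →
    RingDefinableOver R D (X ∩ {x | ∀ i, x i ∈ D})

/-- The ideal `e R` as a subset of `R`. -/
def idemIdeal {R : Type*} [CommRing R] (e : R) : Set R := {x | ∃ r : R, x = e * r}

/-- The places of `K`: the infinite ones and the finite ones. -/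
abbrev AdelePlace (K : Type*) [Field K] [NumberField K] :=
  NumberField.InfinitePlace K ⊕ IsDedekindDomain.HeightOneSpectrum (NumberField.RingOfIntegers K)

namespace AdelePlace

/-- The local field `K_v`. -/
def LocalField {K : Type*} [Field K] [NumberField K] : AdelePlace K → Type _
  | .inl v => v.Completion
  | .inr v => v.adicCompletion K

noncomputable instance {K : Type*} [Field K] [NumberField K] :
    (v : AdelePlace K) → Field (LocalField v)
  | .inl v => inferInstanceAs (Field v.Completion)
  | .inr v => inferInstanceAs (Field (v.adicCompletion K))

/-- The coordinate `a(v) ∈ K_v` of an adele `a`. -/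
def coord {K : Type*} [Field K] [NumberField K] :
    (v : AdelePlace K) → NumberField.AdeleRing (NumberField.RingOfIntegers K) K → LocalField v
  | .inl v, a => a.1 v
  | .inr v, a => a.2 v

end AdelePlace

/-! An idempotent `e` splits `R` as a product of a ring `S`, any quotient by the annihilator of `e`,
and `R ⧸ (e)`. By Feferman–Vaught (`exists_finset_formula_of_prod`), once the second coordinates are
fixed, a formula about `R` becomes a formula about `S`. On `(e R)ⁿ` the variables are all `0` in `R
⧸ (e)` and the parameters are constant, so one formula about `S` describes the whole trace
(`RingDefinable.exists_trace`). Interpreting `S` back in `R` by means of `e` gives stable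
embeddedness.

All this holds for any idempotent of any commutative ring. Of the adeles it is only used that
coordinates separate them, that every element of `K_v` extends by zero to an adele, and that
idempotents of a field are `0` or `1`. -/

namespace FirstOrder.Ring

/-! ### Formulas in products and quotients of rings -/

open FirstOrder.Language

/-- A ring homomorphism, as a homomorphism of structures for the language of rings. -/
def languageHomOfRingHom {R S : Type*} [CommRing R] [CommRing S] [CompatibleRing R]
    [CompatibleRing S] (f : R →+* S) : Language.ring.Hom R S where
  toFun := f
  map_fun' := fun g => by cases g <;> simp
  map_rel' := fun r => by cases r

theorem realize_comp_ringHom {R S β : Type*} [CommRing R] [CommRing S] [CompatibleRing R]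
    [CompatibleRing S] (f : R →+* S) (t : Language.ring.Term β) (v : β → R) :
    t.realize (f ∘ v) = f (t.realize v) :=
  HomClass.realize_term (languageHomOfRingHom f)

theorem realize_sumElim_comp_ringHom {R S β γ : Type*} [CommRing R] [CommRing S]
    [CompatibleRing R] [CompatibleRing S] (f : R →+* S) (t : Language.ring.Term (β ⊕ γ))
    (v : β → R) (xs : γ → R) :
    t.realize (Sum.elim (f ∘ v) (f ∘ xs)) = f (t.realize (Sum.elim v xs)) := by
  rw [← Sum.comp_elim, realize_comp_ringHom]

/-- **Feferman–Vaught** for a product of two rings, with projections `p` and `q`: for fixed second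
coordinates, a formula about the product is one of finitely many formulas about the first
coordinates. -/
theorem exists_finset_formula_of_prod {R S T β : Type*} [CommRing R] [CommRing S] [CommRing T]
    [CompatibleRing R] [CompatibleRing S] [CompatibleRing T] (p : R →+* S) (q : R →+* T)
    (hsurj : ∀ s t, ∃ a, p a = s ∧ q a = t) (hinj : ∀ a b, p a = p b → q a = q b → a = b)
    {n : ℕ} (φ : Language.ring.BoundedFormula β n) :
    ∃ Ψ : Set (Language.ring.BoundedFormula β n), Ψ.Finite ∧
      ∀ (w : β → T) (ws : Fin n → T), ∃ ψ ∈ Ψ, ∀ (v : β → R) (xs : Fin n → R),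
        q ∘ v = w → q ∘ xs = ws → (φ.Realize v xs ↔ ψ.Realize (p ∘ v) (p ∘ xs)) := by
  induction φ with
  | falsum => exact ⟨{⊥}, Set.finite_singleton _, fun _ _ => ⟨⊥, rfl, fun _ _ _ _ => Iff.rfl⟩⟩
  | equal t₁ t₂ =>
    refine ⟨{.equal t₁ t₂, ⊥}, (Set.finite_singleton _).insert _, fun w ws => ?_⟩
    -- The second coordinates alone decide between the two cases: if they already differ the
    -- equation is false, otherwise only the first coordinates matter.
    by_cases h : t₁.realize (Sum.elim w ws) = t₂.realize (Sum.elim w ws)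
    · refine ⟨_, Or.inl rfl, ?_⟩
      rintro v xs rfl rfl
      rw [realize_sumElim_comp_ringHom, realize_sumElim_comp_ringHom] at h
      simp only [BoundedFormula.Realize, realize_sumElim_comp_ringHom]
      exact ⟨fun h' => by rw [h'], fun h' => hinj _ _ h' h⟩
    · refine ⟨_, Or.inr rfl, ?_⟩
      rintro v xs rfl rfl
      rw [realize_sumElim_comp_ringHom, realize_sumElim_comp_ringHom] at h
      simp only [BoundedFormula.Realize]
      exact ⟨fun h' => h (by rw [h']), False.elim⟩
  | rel r _ => cases r
  | imp φ₁ φ₂ ih₁ ih₂ =>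
    obtain ⟨Ψ₁, hf₁, h₁⟩ := ih₁
    obtain ⟨Ψ₂, hf₂, h₂⟩ := ih₂
    refine ⟨Set.image2 .imp Ψ₁ Ψ₂, hf₁.image2 _ hf₂, fun w ws => ?_⟩
    obtain ⟨ψ₁, hm₁, e₁⟩ := h₁ w ws
    obtain ⟨ψ₂, hm₂, e₂⟩ := h₂ w ws
    refine ⟨_, Set.mem_image2_of_mem hm₁ hm₂, fun v xs hv hx => ?_⟩
    rw [BoundedFormula.realize_imp, BoundedFormula.realize_imp, e₁ v xs hv hx, e₂ v xs hv hx]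
  | all φ ih =>
    obtain ⟨Ψ, hf, h⟩ := ih
    -- Finiteness of `Ψ` is carried through the induction for this step: a conjunction over a subset
    -- of `Ψ` must be a formula.
    have hall : ∀ s : Set (Language.ring.BoundedFormula β _), s ⊆ Ψ →
        ∃ χ : Language.ring.BoundedFormula β _, ∀ (v : β → S) xs,
          χ.Realize v xs ↔ ∀ ψ ∈ s, ψ.all.Realize v xs := by
      intro s hs
      have := (hf.subset hs).to_subtype
      refine ⟨BoundedFormula.iInf fun ψ : s => ψ.1.all, fun v xs => ?_⟩
      rw [BoundedFormula.realize_iInf]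
      exact Subtype.forall
    choose! χ hχ using hall
    refine ⟨χ '' Ψ.powerset, hf.powerset.image _, fun w ws => ?_⟩
    -- A quantifier over the product runs over pairs `(s, t)`. The choice of `t` matters only
    -- through the formula `ψ` it induces, so take the conjunction of `∀ s, ψ` over those `ψ` that
    -- some `t` induces.
    refine ⟨_, ⟨{ψ ∈ Ψ | ∃ t : T, ∀ v xs, q ∘ v = w → q ∘ xs = Fin.snoc ws t →
      (φ.Realize v xs ↔ ψ.Realize (p ∘ v) (p ∘ xs))}, Set.sep_subset _ _, rfl⟩, ?_⟩
    rintro v xs hv hx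
    rw [hχ _ (Set.sep_subset _ _)]
    simp only [BoundedFormula.realize_all]
    constructor
    · rintro H ψ ⟨-, t, ht⟩ s
      obtain ⟨a, rfl, rfl⟩ := hsurj s t
      rw [← Fin.comp_snoc, ← ht v _ hv (by rw [Fin.comp_snoc, hx])]
      exact H a
    · intro H a
      obtain ⟨ψ, hψ, e⟩ := h w (Fin.snoc ws (q a))
      rw [e v _ hv (by rw [Fin.comp_snoc, hx]), Fin.comp_snoc]
      exact H ψ ⟨hψ, q a, e⟩ (p a)

/-- Formulas about a quotient ring `S` of `R`, whose kernel is the annihilator of `e`, can be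
interpreted in `R` with the parameter `e`. -/
theorem exists_formula_of_quotient {R S β : Type*} [CommRing R] [CommRing S]
    [CompatibleRing R] [CompatibleRing S] (p : R →+* S) (hp : Function.Surjective p) {e : R}
    (he : ∀ a b, p a = p b ↔ e * a = e * b) {n : ℕ} (φ : Language.ring.BoundedFormula β n) :
    ∃ ψ : Language.ring.BoundedFormula (Unit ⊕ β) n, ∀ (v : β → R) (xs : Fin n → R),
      ψ.Realize (Sum.elim (fun _ => e) v) xs ↔ φ.Realize (p ∘ v) (p ∘ xs) := by
  induction φ with
  | falsum => exact ⟨⊥, fun _ _ => Iff.rfl⟩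
  | @equal n t₁ t₂ =>
    let g : β ⊕ Fin n → (Unit ⊕ β) ⊕ Fin n := Sum.map Sum.inr id
    let c : Language.ring.Term ((Unit ⊕ β) ⊕ Fin n) := .var (Sum.inl (Sum.inl ()))
    -- Equality in `S` is equality in `R` after multiplication by `e`.
    refine ⟨.equal (c * t₁.relabel g) (c * t₂.relabel g), fun v xs => ?_⟩
    have hg : Sum.elim (Sum.elim (fun _ => e) v) xs ∘ g = Sum.elim v xs := by
      ext i; cases i <;> rfl
    simp only [BoundedFormula.Realize, realize_sumElim_comp_ringHom, he, realize_mul,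
      Term.realize_relabel, hg]
    rfl
  | rel r _ => cases r
  | imp φ₁ φ₂ ih₁ ih₂ =>
    obtain ⟨ψ₁, h₁⟩ := ih₁
    obtain ⟨ψ₂, h₂⟩ := ih₂
    exact ⟨ψ₁.imp ψ₂, fun v xs => by
      rw [BoundedFormula.realize_imp, BoundedFormula.realize_imp, h₁, h₂]⟩
  | all φ ih =>
    obtain ⟨ψ, h⟩ := ih
    refine ⟨ψ.all, fun v xs => ?_⟩
    simp only [BoundedFormula.realize_all, h, Fin.comp_snoc]
    exact hp.forall (p := fun a => φ.Realize (p ∘ v) (Fin.snoc (p ∘ xs) a)) |>.symm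

end FirstOrder.Ring

/-! ### Traces and preimages of definable sets -/

section RingDefinable

open FirstOrder FirstOrder.Language

variable {R S : Type*} [CommRing R] [CommRing S] {n : ℕ}

/-- The trace on `(e R)ⁿ` of a definable subset of `Rⁿ` is definable in any quotient ring of `R`
whose kernel is the annihilator of the idempotent `e`. -/
theorem RingDefinable.exists_trace {e : R} (hidem : IsIdempotentElem e) (p : R →+* S)
    (hp : Function.Surjective p) (he : ∀ a b, p a = p b ↔ e * a = e * b)
    {X : Set (Fin n → R)} (hX : RingDefinable R X) :
    ∃ Y : Set (Fin n → S), RingDefinable S Y ∧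
      ∀ x : Fin n → R, (∀ i, x i ∈ idemIdeal e) → (x ∈ X ↔ p ∘ x ∈ Y) := by
  let _ := Ring.compatibleRingOfRing R
  let _ := Ring.compatibleRingOfRing S
  let _ := Ring.compatibleRingOfRing (R ⧸ Ideal.span {e})
  obtain ⟨φ, hφ⟩ := Set.definable_iff_exists_formula_sum.1 hX
  let q := Ideal.Quotient.mk (Ideal.span {e})
  have hq : ∀ a b, q a = q b ↔ e ∣ a - b := fun a b => by
    rw [Ideal.Quotient.eq, Ideal.mem_span_singleton]
  have hidem' : e * e = e := hidem
  obtain ⟨Ψ, -, hΨ⟩ := Ring.exists_finset_formula_of_prod p q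
    (fun s t => by
      obtain ⟨a, rfl⟩ := hp s
      obtain ⟨b, rfl⟩ := Ideal.Quotient.mk_surjective t
      -- Chinese remainder gluing along `e` and `1 - e`.
      refine ⟨e * a + (1 - e) * b, (he _ _).2 ?_, (hq _ _).2 ⟨a - b, by ring⟩⟩
      linear_combination (a - b) * hidem')
    (fun a b h₁ h₂ => by
      rw [he] at h₁
      obtain ⟨c, hc⟩ := (hq _ _).1 h₂
      linear_combination h₁ + (1 - e) * hc - c * hidem') φ
  -- Elements of `e R` vanish modulo `e`, so the variables get second coordinate `0`; hence `ψ` does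
  -- not depend on the point.
  obtain ⟨ψ, -, hψ⟩ := hΨ (Sum.elim (fun a => q a.1) fun _ => 0) default
  refine ⟨{y | Formula.Realize ψ (Sum.elim (fun a => p a.1) y)},
    Set.definable_iff_exists_formula_sum.2
      ⟨Formula.relabel (Sum.map (fun a => ⟨p a.1, trivial⟩) id) ψ, ?_⟩, fun x hx => ?_⟩
  · ext y
    simp only [Set.mem_ofPred_eq, Formula.realize_relabel]
    congr! 1
    ext i; cases i <;> rfl
  · rw [hφ]
    simp only [Set.mem_ofPred_eq]
    refine (hψ _ default ?_ (Subsingleton.elim _ _)).trans ?_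
    · ext i
      cases i with
      | inl a => rfl
      | inr i =>
        obtain ⟨r, hr⟩ := hx i
        exact (hq (x i) 0).2 ⟨r, by rw [hr, sub_zero]⟩
    · rw [Formula.Realize, Sum.comp_elim, Subsingleton.elim (p ∘ default) default]
      rfl

/-- The preimage of a definable set under a quotient map `p : R → S` whose kernel is the
annihilator of `e` is definable over any set of parameters which contains `e` and maps onto `S`. -/
theorem RingDefinable.preimage_comp {e : R} (p : R →+* S) {D : Set R} (heD : e ∈ D)
    (hp : ∀ s, ∃ d ∈ D, p d = s) (he : ∀ a b, p a = p b ↔ e * a = e * b)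
    {Y : Set (Fin n → S)} (hY : RingDefinable S Y) :
    RingDefinableOver R D {x | p ∘ x ∈ Y} := by
  let _ := Ring.compatibleRingOfRing R
  let _ := Ring.compatibleRingOfRing S
  obtain ⟨φ, hφ⟩ := Set.definable_iff_exists_formula_sum.1 hY
  obtain ⟨ψ, hψ⟩ := Ring.exists_formula_of_quotient p
    (fun s => (hp s).imp fun _ h => h.2) he φ
  -- Each parameter from `S` is replaced by a lift in `D`.
  choose d hdD hd using hp
  refine Set.definable_iff_exists_formula_sum.2 ⟨Formula.relabel
    (Sum.elim (fun _ => Sum.inl ⟨e, heD⟩) (Sum.map (fun a => ⟨d a.1, hdD a.1⟩) id)) ψ, ?_⟩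
  ext x
  have h := hψ (Sum.elim (fun a => d a.1) x) default
  rw [Subsingleton.elim (p ∘ default) default, Sum.comp_elim] at h
  simp only [hφ, Set.mem_ofPred_eq, Formula.realize_relabel]
  convert h.symm using 1
  · simp only [Formula.Realize]
    congr! 2
    ext a
    exact (hd _).symm
  · simp only [Formula.Realize]
    congr! 1
    ext i
    rcases i with _ | _ | _ <;> rfl

theorem ringDefinableOver_pi_idemIdeal {e : R} (hidem : IsIdempotentElem e) (n : ℕ) :
    RingDefinableOver R (idemIdeal e) {x : Fin n → R | ∀ i, x i ∈ idemIdeal e} := by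
  let _ := Ring.compatibleRingOfRing R
  have hset : {x : Fin n → R | ∀ i, x i ∈ idemIdeal e} = ⋂ i, {x : Fin n → R | e * x i = x i} := by
    ext x
    simp only [Set.mem_iInter, Set.mem_ofPred_eq]
    refine forall_congr' fun i => ⟨?_, fun h => ⟨x i, h.symm⟩⟩
    rintro ⟨r, hr⟩
    rw [hr, ← mul_assoc, hidem.eq]
  rw [hset]
  refine Set.definable_iInter_of_finite fun i => Set.definable_iff_exists_formula_sum.2 ?_
  let c : Language.ring.Term (idemIdeal e ⊕ Fin n) := .var (Sum.inl ⟨e, 1, (mul_one e).symm⟩)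
  let y : Language.ring.Term (idemIdeal e ⊕ Fin n) := .var (Sum.inr i)
  refine ⟨(c * y).equal y, ?_⟩
  ext x
  simp [c, y]

end RingDefinable

/-! ### The ring `e R` with unit `e` -/

section Corner

variable {R : Type*} [CommRing R] {e : R}

/-- Multiplication by the idempotent `e`, as a ring homomorphism onto the ring `e R`. -/
def IsIdempotentElem.toCorner (he : IsIdempotentElem e) : R →+* he.Corner where
  toFun a := ⟨e * a * e, a, rfl⟩
  map_one' := Subtype.ext (show e * 1 * e = e by rw [mul_one, he.eq])
  map_mul' a b := Subtype.ext <| by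
    have he' : e * e = e := he
    change e * (a * b) * e = e * a * e * (e * b * e)
    linear_combination (-(a * b) * (e ^ 2 + e)) * he'
  map_zero' := Subtype.ext (by simp; rfl)
  map_add' a b := Subtype.ext <| by
    change e * (a + b) * e = e * a * e + e * b * e
    ring

theorem IsIdempotentElem.coe_toCorner (he : IsIdempotentElem e) (a : R) :
    (he.toCorner a).1 = e * a := by
  have he' : e * e = e := he
  change e * a * e = e * a
  linear_combination a * he'

theorem IsIdempotentElem.mul_coe_corner (he : IsIdempotentElem e) (x : he.Corner) :
    e * x.1 = x.1 :=
  ((Subsemigroup.mem_corner_iff he).1 x.2).1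

theorem IsIdempotentElem.toCorner_coe (he : IsIdempotentElem e) (x : he.Corner) :
    he.toCorner x.1 = x :=
  Subtype.ext (by rw [he.coe_toCorner, he.mul_coe_corner])

theorem IsIdempotentElem.toCorner_eq_iff (he : IsIdempotentElem e) (a b : R) :
    he.toCorner a = he.toCorner b ↔ e * a = e * b := by
  rw [← he.coe_toCorner, ← he.coe_toCorner]
  exact ⟨congrArg Subtype.val, Subtype.ext⟩

theorem IsIdempotentElem.coe_mem_idemIdeal (he : IsIdempotentElem e) (x : he.Corner) :
    x.1 ∈ idemIdeal e :=
  ⟨x.1, (he.mul_coe_corner x).symm⟩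

theorem RingDefinable.corner (he : IsIdempotentElem e) {n : ℕ} {X : Set (Fin n → R)}
    (hX : RingDefinable R X) :
    RingDefinable he.Corner {x : Fin n → he.Corner | (fun i => (x i).1) ∈ X} := by
  obtain ⟨Y, hY, h⟩ := hX.exists_trace he he.toCorner (fun x => ⟨x.1, he.toCorner_coe x⟩)
    he.toCorner_eq_iff
  convert hY using 1
  ext x
  rw [Set.mem_ofPred_eq, h _ fun i => he.coe_mem_idemIdeal (x i)]
  congr! 1
  ext i
  exact he.toCorner_coe (x i)

/-- The trace is described inside `e R`, then pulled back to `R`; since parameters of `e R` lift to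
themselves, none from outside `e R` is needed. -/
theorem IsIdempotentElem.isStablyEmbedded (he : IsIdempotentElem e) :
    IsStablyEmbedded R (idemIdeal e) := by
  intro n X hX
  obtain ⟨Y, hY, h⟩ := hX.exists_trace he he.toCorner (fun x => ⟨x.1, he.toCorner_coe x⟩)
    he.toCorner_eq_iff
  have hXY : X ∩ {x | ∀ i, x i ∈ idemIdeal e} =
      {x | he.toCorner ∘ x ∈ Y} ∩ {x | ∀ i, x i ∈ idemIdeal e} := by
    ext x
    exact and_congr_left fun hx => h x hx
  rw [hXY]
  let _ := FirstOrder.Ring.compatibleRingOfRing R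
  have heD : e ∈ idemIdeal e := ⟨1, (mul_one e).symm⟩
  exact Set.Definable.inter
    (hY.preimage_comp he.toCorner heD
      (fun s => ⟨s.1, he.coe_mem_idemIdeal s, he.toCorner_coe s⟩) he.toCorner_eq_iff)
    (ringDefinableOver_pi_idemIdeal he n)

end Corner

/-! ### Minimal idempotents of the adele ring and places -/

namespace AdelePlace

open NumberField

variable {K : Type*} [Field K] [NumberField K]

/-- The coordinate of adeles at the place `v`, as a ring homomorphism. -/
def coordHom (v : AdelePlace K) : AdeleRing (RingOfIntegers K) K →+* v.LocalField where
  toFun := v.coord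
  map_one' := by cases v <;> rfl
  map_mul' _ _ := by cases v <;> rfl
  map_zero' := by cases v <;> rfl
  map_add' _ _ := by cases v <;> rfl

theorem ext_coord {a b : AdeleRing (RingOfIntegers K) K}
    (h : ∀ v : AdelePlace K, v.coordHom a = v.coordHom b) : a = b :=
  Prod.ext (funext fun v => h (.inl v)) (Subtype.ext (funext fun v => h (.inr v)))

theorem exists_single (v : AdelePlace K) (y : v.LocalField) :
    ∃ a : AdeleRing (RingOfIntegers K) K, v.coordHom a = y ∧
      ∀ w : AdelePlace K, w ≠ v → w.coordHom a = 0 := by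
  classical
  cases v with
  | inl v =>
    refine ⟨(Pi.single v y, 0), Pi.single_eq_same v y, ?_⟩
    rintro (w | w) hw
    · exact Pi.single_eq_of_ne (fun h => hw (congrArg _ h)) y
    · rfl
  | inr v =>
    let A := fun v : IsDedekindDomain.HeightOneSpectrum (RingOfIntegers K) =>
      v.adicCompletionIntegers K
    refine ⟨(0, RestrictedProduct.single A v y), RestrictedProduct.single_eq_same A v y, ?_⟩
    rintro (w | w) hw
    · rfl
    · exact RestrictedProduct.single_eq_of_ne A y (fun h => hw (congrArg _ h))

theorem coordHom_eq_zero_or_one (v : AdelePlace K) {f : AdeleRing (RingOfIntegers K) K}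
    (hf : IsIdempotentElem f) : v.coordHom f = 0 ∨ v.coordHom f = 1 :=
  IsIdempotentElem.iff_eq_zero_or_one.1 (hf.map v.coordHom)

variable {e : AdeleRing (RingOfIntegers K) K} {v : AdelePlace K}

theorem isMinimalIdempotent_of_coord (h₁ : v.coordHom e = 1)
    (h₀ : ∀ w : AdelePlace K, w ≠ v → w.coordHom e = 0) : IsMinimalIdempotent e where
  idem := ext_coord fun w => by
    by_cases hw : w = v
    · subst hw; simp [h₁]
    · simp [h₀ w hw]
  ne_zero := by rintro rfl; simp at h₁
  minimal f hf hfe := by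
    have hw₀ : ∀ w : AdelePlace K, w ≠ v → w.coordHom f = 0 := fun w hw => by
      rw [← hfe, map_mul, h₀ w hw, mul_zero]
    refine (v.coordHom_eq_zero_or_one hf).imp (fun h => ?_) (fun h => ?_) <;>
    · refine ext_coord fun w => ?_
      by_cases hw : w = v
      · subst hw; simp [h, h₁]
      · simp [h₀ w hw, hw₀ w hw]

/-- The indicator `f` of `v` is a nonzero idempotent below `e`, so minimality forces `f = e`. -/
theorem coordHom_eq_zero_of_ne (he : IsMinimalIdempotent e) (h₁ : v.coordHom e = 1)
    {w : AdelePlace K} (hw : w ≠ v) : w.coordHom e = 0 := by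
  obtain ⟨f, hf₁, hf₀⟩ := v.exists_single 1
  have hfe : f * e = f := ext_coord fun u => by
    by_cases hu : u = v
    · subst hu; simp [h₁, hf₁]
    · simp [hf₀ u hu]
  rcases he.minimal f (isMinimalIdempotent_of_coord hf₁ hf₀).idem hfe with rfl | rfl
  · simp at hf₁
  · exact hf₀ w hw

theorem existsUnique_isMinimalIdempotent (v : AdelePlace K) :
    ∃! e : AdeleRing (RingOfIntegers K) K, IsMinimalIdempotent e ∧ v.coordHom e = 1 := by
  obtain ⟨f, hf₁, hf₀⟩ := v.exists_single 1
  refine ⟨f, ⟨isMinimalIdempotent_of_coord hf₁ hf₀, hf₁⟩, fun e ⟨he, h₁⟩ => ext_coord fun w => ?_⟩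
  by_cases hw : w = v
  · subst hw; rw [h₁, hf₁]
  · rw [coordHom_eq_zero_of_ne he h₁ hw, hf₀ w hw]

theorem exists_coordHom_eq_one (he : IsMinimalIdempotent e) :
    ∃ v : AdelePlace K, v.coordHom e = 1 := by
  by_contra! h
  exact he.ne_zero <| ext_coord fun v => by
    rw [(v.coordHom_eq_zero_or_one he.idem).resolve_right (h v), map_zero]

theorem coordHom_surjective (v : AdelePlace K) : Function.Surjective v.coordHom := fun y =>
  (v.exists_single y).imp fun _ h => h.1

theorem coordHom_eq_iff (he : IsMinimalIdempotent e) (h₁ : v.coordHom e = 1)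
    (a b : AdeleRing (RingOfIntegers K) K) :
    v.coordHom a = v.coordHom b ↔ e * a = e * b := by
  refine ⟨fun h => ext_coord fun w => ?_, fun h => ?_⟩
  · by_cases hw : w = v
    · subst hw; rw [map_mul, map_mul, h]
    · simp [coordHom_eq_zero_of_ne he h₁ hw]
  · simpa [h₁] using congrArg v.coordHom h

/-- The coordinate at `v` as an isomorphism from `e 𝔸_K` onto `K_v`, for the minimal idempotent
`e` of the place `v`. -/
noncomputable def cornerEquiv (he : IsMinimalIdempotent e) (h₁ : v.coordHom e = 1) :
    he.idem.Corner ≃+* v.LocalField :=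
  RingEquiv.ofBijective
    ({ toFun := fun x => v.coordHom x.1
       map_one' := h₁
       map_mul' := fun x y => v.coordHom.map_mul x.1 y.1
       map_zero' := v.coordHom.map_zero
       map_add' := fun x y => v.coordHom.map_add x.1 y.1 } : he.idem.Corner →+* v.LocalField)
    ⟨fun x y h => Subtype.ext <| by
      rw [← he.idem.mul_coe_corner x, ← he.idem.mul_coe_corner y]
      exact (coordHom_eq_iff he h₁ _ _).1 h,
    fun y => by
      obtain ⟨a, rfl⟩ := v.coordHom_surjective y
      refine ⟨he.idem.toCorner a, ?_⟩
      change v.coordHom (he.idem.toCorner a).1 = _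
      rw [he.idem.coe_toCorner, map_mul, h₁, one_mul]⟩

theorem ringDefinable_localField (he : IsMinimalIdempotent e) (h₁ : v.coordHom e = 1) {n : ℕ}
    {X : Set (Fin n → AdeleRing (RingOfIntegers K) K)}
    (hX : RingDefinable (AdeleRing (RingOfIntegers K) K) X) :
    RingDefinable v.LocalField
      {y : Fin n → v.LocalField | (fun i => ((cornerEquiv he h₁).symm (y i)).1) ∈ X} := by
  -- `K_v` is itself a quotient of the adeles by the annihilator of `e`, so no transfer of formulas
  -- along `cornerEquiv` is needed.
  obtain ⟨Y, hY, h⟩ := hX.exists_trace he.idem v.coordHom v.coordHom_surjective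
    (coordHom_eq_iff he h₁)
  convert hY using 1
  ext y
  rw [Set.mem_ofPred_eq, h _ fun i => he.idem.coe_mem_idemIdeal _]
  congr! 1
  ext i
  exact (cornerEquiv he h₁).apply_symm_apply (y i)

end AdelePlace

theorem mainTheorem7 (K : Type*) [Field K] [NumberField K] :
    -- every place `v` of `K` comes from exactly one minimal idempotent of the adele ring
    (∀ v : AdelePlace K, ∃! e : NumberField.AdeleRing (NumberField.RingOfIntegers K) K,
      IsMinimalIdempotent e ∧ v.coord e = 1) ∧
    ∀ (e : NumberField.AdeleRing (NumberField.RingOfIntegers K) K) (he : IsMinimalIdempotent e),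
      -- `e 𝔸_K` is stably embedded in `𝔸_K`
      IsStablyEmbedded (NumberField.AdeleRing (NumberField.RingOfIntegers K) K) (idemIdeal e) ∧
      -- the trace on `(e 𝔸_K)ⁿ` of a definable set is definable in the ring `e 𝔸_K` (with unit `e`)
      (∀ (n : ℕ), 1 ≤ n →
        ∀ X : Set (Fin n → NumberField.AdeleRing (NumberField.RingOfIntegers K) K),
          RingDefinable (NumberField.AdeleRing (NumberField.RingOfIntegers K) K) X →
          RingDefinable he.idem.Corner {x : Fin n → he.idem.Corner | (fun i => (x i).1) ∈ X}) ∧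
      -- `e` is the idempotent of a unique place `v`, the coordinate at `v` is an isomorphism from
      -- `e 𝔸_K` onto `K_v`, and the trace of a definable set, read in `K_v`, is definable in `K_v`
      ∃ v : AdelePlace K, v.coord e = 1 ∧ (∀ w : AdelePlace K, w ≠ v → w.coord e = 0) ∧
        ∃ φ : he.idem.Corner ≃+* v.LocalField, (∀ x, φ x = v.coord x.1) ∧
          ∀ (n : ℕ), 1 ≤ n →
            ∀ X : Set (Fin n → NumberField.AdeleRing (NumberField.RingOfIntegers K) K),
              RingDefinable (NumberField.AdeleRing (NumberField.RingOfIntegers K) K) X →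
              RingDefinable v.LocalField
                {y : Fin n → v.LocalField | (fun i => (φ.symm (y i)).1) ∈ X} := by
  refine ⟨fun v => v.existsUnique_isMinimalIdempotent, fun e he =>
    ⟨he.idem.isStablyEmbedded, fun n _ X hX => hX.corner he.idem, ?_⟩⟩
  obtain ⟨v, h₁⟩ := AdelePlace.exists_coordHom_eq_one he
  exact ⟨v, h₁, fun w hw => AdelePlace.coordHom_eq_zero_of_ne he h₁ hw,
    AdelePlace.cornerEquiv he h₁, fun _ => rfl,
    fun n _ X hX => AdelePlace.ringDefinable_localField he h₁ hX⟩
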